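/- Let $\mathbb{H}$ be the quaternions, $\mathbb{S}=\{I\in\mathbb{H}: I^2=-1\}$ and $L_I=\mathbb{R}+I\mathbb{R}$ for $I\in\mathbb{S}$. Let $\Omega\subseteq\mathbb{H}$ be a domain (a non-empty connected open set for the Euclidean topology). A function $f:\Omega\to\mathbb{H}$ is called regular if, for every $I\in\mathbb{S}$, its restriction $f_I$ to $\Omega_I=\Omega\cap L_I$ is holomorphic, i.e. $f_I$ is real differentiable and $\frac12\left(\frac{\partial}{\partial x}+I\frac{\partial}{\partial y}\right)f_I(x+Iy)=0$ on $\Omega_I$. The slice derivative $f'$ of a regular function $f$ is the regular function on $\Omega$ that equals $\frac12\left(\frac{\partial}{\partial x}-I\frac{\partial}{\partial y}\right)f_I(x+Iy)$ on $\Omega_I$ for every $I\in\mathbb{S}$, and $f^{(n)}$ is the $n$-th slice derivative. For $p,q\in\mathbb{H}$ let $\sigma(q,p)=|q-p|$ if $p$ and $q$ lie on the same complex line $L_I$ for some $I\in\mathbb{S}$, and $$\sigma(q,p)=\sqrt{\left[\mathrm{Re}(q)-\mathrm{Re}(p)\right]^2+\left[|\mathrm{Im}(q)|+|\mathrm{Im}(p)|\right]^2}$$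 otherwise, and let $\Sigma(p,R)=\{q\in\mathbb{H}:\sigma(q,p)<R\}$. Finally, let $(q-p)^{*n}$ be the $n$-th power of the polynomial $q-p$ in the variable $q$ with respect to the regular multiplication $\left(\sum_n q^n a_n\right)*\left(\sum_n q^n b_n\right)=\sum_n q^n\sum_{k=0}^n a_k b_{n-k}$. Theorem. Let $f$ be a regular function on a domain $\Omega\subseteq\mathbb{H}$. Then the slice derivatives $f^{(n)}$ of all orders are well defined and regular on $\Omega$. Moreover, for every $p\in\Omega$ and every $\sigma$-ball $\Sigma(p,R)$ contained in $\Omega$, $$f(q)=\sum_{n\in\mathbb{N}}(q-p)^{*n}f^{(n)}(p)\frac{1}{n!}\qquad\text{for all } q\in\Sigma(p,R),$$ where the series converges absolutely with respect to the Euclidean norm. -/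

import Mathlib

open scoped Quaternion Nat

noncomputable section

namespace SliceRegular

/-- The set `𝕊` of quaternionic imaginary units. -/
def imagUnits : Set ℍ[ℝ] := {I | I ^ 2 = -1}

/-- The point `x + I y` of the complex line `L_I`. -/
def slicePoint (I : ℍ[ℝ]) (x y : ℝ) : ℍ[ℝ] := (x : ℍ[ℝ]) + I * (y : ℍ[ℝ])

/-- The complex line `L_I = ℝ + I ℝ`. -/
def complexLine (I : ℍ[ℝ]) : Set ℍ[ℝ] := {q | ∃ x y : ℝ, q = slicePoint I x y}

/-- `ω(q, p)`. -/
def omegaDist (q p : ℍ[ℝ]) : ℝ :=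
  Real.sqrt ((q.re - p.re) ^ 2 + (‖q.im‖ + ‖p.im‖) ^ 2)

open Classical in
/-- `σ(q, p)`: the Euclidean distance if `p` and `q` lie on the same complex line, and
`ω(q, p)` otherwise. -/
def sigmaDist (q p : ℍ[ℝ]) : ℝ :=
  if ∃ I ∈ imagUnits, p ∈ complexLine I ∧ q ∈ complexLine I then ‖q - p‖ else omegaDist q p

/-- The `σ`-ball `Σ(p, R)`. -/
def sigmaBall (p : ℍ[ℝ]) (R : ℝ) : Set ℍ[ℝ] := {q | sigmaDist q p < R}

/-- The value `∑ qⁿ aₙ` at `q` of a polynomial with coefficients `aₙ` on the right. (Mathlib's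
`Polynomial.eval` puts the coefficients on the left.) -/
def rightEval (P : Polynomial ℍ[ℝ]) (q : ℍ[ℝ]) : ℍ[ℝ] := P.sum fun n a => q ^ n * a

/-- The regular power `(q - p)^{*n}`. The regular product of polynomials convolves the coefficient
sequences, `(∑ qⁿ aₙ) * (∑ qⁿ bₙ) = ∑ qⁿ ∑ₖ aₖ bₙ₋ₖ`, which is the multiplication of
`Polynomial ℍ[ℝ]`; so this is the `n`-th power of `X - p` in that ring, evaluated at `q`. -/
def regularPow (q p : ℍ[ℝ]) (n : ℕ) : ℍ[ℝ] :=
  rightEval ((Polynomial.X - Polynomial.C p) ^ n) q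

/-- The partial derivative `∂/∂x` of `f_I` at `x + I y`. -/
def partialX (I : ℍ[ℝ]) (f : ℍ[ℝ] → ℍ[ℝ]) (x y : ℝ) : ℍ[ℝ] :=
  deriv (fun t : ℝ => f (slicePoint I t y)) x

/-- The partial derivative `∂/∂y` of `f_I` at `x + I y`. -/
def partialY (I : ℍ[ℝ]) (f : ℍ[ℝ] → ℍ[ℝ]) (x y : ℝ) : ℍ[ℝ] :=
  deriv (fun t : ℝ => f (slicePoint I x t)) y

/-- `∂̄_I f (x + I y) = ½ (∂/∂x + I ∂/∂y) f_I (x + I y)`. -/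
def dbarSlice (I : ℍ[ℝ]) (f : ℍ[ℝ] → ℍ[ℝ]) (x y : ℝ) : ℍ[ℝ] :=
  (1 / 2 : ℝ) • (partialX I f x y + I * partialY I f x y)

/-- `∂_I f (x + I y) = ½ (∂/∂x - I ∂/∂y) f_I (x + I y)`. -/
def dSlice (I : ℍ[ℝ]) (f : ℍ[ℝ] → ℍ[ℝ]) (x y : ℝ) : ℍ[ℝ] :=
  (1 / 2 : ℝ) • (partialX I f x y - I * partialY I f x y)

/-- `f` is (slice) regular on `Ω`: for every imaginary unit `I`, the restriction `f_I` of `f` to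
`Ω ∩ L_I` is holomorphic, that is, real differentiable with `∂̄_I f = 0`. -/
def IsRegularOn (f : ℍ[ℝ] → ℍ[ℝ]) (Ω : Set ℍ[ℝ]) : Prop :=
  ∀ I ∈ imagUnits, ∀ x y : ℝ, slicePoint I x y ∈ Ω →
    DifferentiableAt ℝ (fun z : ℝ × ℝ => f (slicePoint I z.1 z.2)) (x, y) ∧
      dbarSlice I f x y = 0

/-- `g` is the slice derivative of `f` on `Ω`: the regular function that equals `∂_I f` on
`Ω ∩ L_I`, for every imaginary unit `I`. -/
def IsSliceDerivOn (f g : ℍ[ℝ] → ℍ[ℝ]) (Ω : Set ℍ[ℝ]) : Prop :=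
  IsRegularOn g Ω ∧
    ∀ I ∈ imagUnits, ∀ x y : ℝ, slicePoint I x y ∈ Ω → g (slicePoint I x y) = dSlice I f x y

/-- The quaternion `i`. -/
def unitI : ℍ[ℝ] := ⟨0, 1, 0, 0⟩

open Classical in
/-- An imaginary unit `I` with `q = Re q + I |Im q|`: the unit `Im q / |Im q|` if `q` is not real,
and `i` if `q` is real. -/
def sliceUnit (q : ℍ[ℝ]) : ℍ[ℝ] :=
  if q.im = 0 then unitI else ‖q.im‖⁻¹ • q.im

theorem sliceUnit_mem_imagUnits (q : ℍ[ℝ]) : sliceUnit q ∈ imagUnits := by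
  change sliceUnit q ^ 2 = -1
  by_cases h : q.im = 0
  · rw [sliceUnit, if_pos h, sq]
    have h0 : unitI.re = 0 := rfl
    have h1 : unitI.imI = 1 := rfl
    have h2 : unitI.imJ = 0 := rfl
    have h3 : unitI.imK = 0 := rfl
    ext <;> simp [h0, h1, h2, h3]
  · have h0 : ‖q.im‖ ≠ 0 := norm_ne_zero_iff.mpr h
    have h2 : q.im ^ 2 = -((‖q.im‖ ^ 2 : ℝ) : ℍ[ℝ]) := by
      rw [sq ‖q.im‖, ← Quaternion.normSq_eq_norm_mul_self]
      exact Quaternion.sq_eq_neg_normSq.mpr rfl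
    rw [sliceUnit, if_neg h, smul_pow, h2, ← Quaternion.coe_neg, ← Quaternion.coe_smul, smul_eq_mul,
      inv_pow, mul_neg, inv_mul_cancel₀ (pow_ne_zero 2 h0), Quaternion.coe_neg, Quaternion.coe_one]

theorem slicePoint_sliceUnit (q : ℍ[ℝ]) : slicePoint (sliceUnit q) q.re ‖q.im‖ = q := by
  by_cases h : q.im = 0
  · rw [slicePoint, h, norm_zero, Quaternion.coe_zero, mul_zero, add_zero]
    conv_rhs => rw [← Quaternion.re_add_im q, h, add_zero]
  · have h0 : ‖q.im‖ ≠ 0 := norm_ne_zero_iff.mpr h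
    rw [slicePoint, sliceUnit, if_neg h, Quaternion.mul_coe_eq_smul, smul_smul, mul_inv_cancel₀ h0,
      one_smul, Quaternion.re_add_im]

/-- The slice derivative: at `q = x + I y` its value is `∂_I f (x + I y)`. For regular `f` the choice
of `I` does not matter, which `IsSliceDerivOn` records. -/
def sliceDeriv (f : ℍ[ℝ] → ℍ[ℝ]) (q : ℍ[ℝ]) : ℍ[ℝ] :=
  dSlice (sliceUnit q) f q.re ‖q.im‖

/-- The `n`-th slice derivative `f⁽ⁿ⁾`. -/
def iteratedSliceDeriv (n : ℕ) (f : ℍ[ℝ] → ℍ[ℝ]) : ℍ[ℝ] → ℍ[ℝ] := sliceDeriv^[n] f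

end SliceRegular

end

noncomputable section

namespace SliceRegular

/-! ### Imaginary units and the embeddings of `ℂ` onto the lines `L_I` -/

variable {I J : ℍ[ℝ]}


/-! Left multiplication by `L_I` makes `ℍ` a complex normed space, and regularity says that each
`f_I` is holomorphic into it, with the slice derivative as complex derivative
(`hasSliceDerivAt_iff_hasDerivAt`). Derivatives of all orders thus exist and are regular, and `f_I`
has a Taylor series on discs. For `p, q` in `L_I` the regular powers are ordinary powers
(`regularPow_sliceEmb`), so this is the claimed expansion.

If `p` in `L_I` and `q` in `L_J` share no line, the condition `ω(q, p) < R` puts the complex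
coordinate of `q` in two discs, around that of `p` and around its conjugate. On this lens the
representation formula writes `f` on `L_J` through its values on `L_I` and `L_{-I}`
(`IsRegularOn.apply_sliceEmb`). Regular powers obey the same formula (`rightEval_sliceEmb`), so
combining the two Taylor series gives the expansion at `q`. Since `ℍ` is finite dimensional,
`HasSum` entails absolute convergence. -/

theorem mul_self_of_mem_imagUnits (hI : I ∈ imagUnits) : I * I = -1 := by
  rw [← sq]; exact hI

theorem neg_mem_imagUnits (hI : I ∈ imagUnits) : -I ∈ imagUnits := by
  change (-I) ^ 2 = -1
  rw [neg_sq]; exact hI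

theorem norm_of_mem_imagUnits (hI : I ∈ imagUnits) : ‖I‖ = 1 := by
  have h : ‖I‖ ^ 2 = 1 := by
    rw [← norm_pow, show I ^ 2 = -1 from hI, norm_neg, norm_one]
  exact (pow_eq_one_iff_of_nonneg (norm_nonneg _) two_ne_zero).mp h

theorem re_of_mem_imagUnits (hI : I ∈ imagUnits) : I.re = 0 := by
  refine Quaternion.sq_eq_neg_normSq.mp ?_
  rw [Quaternion.normSq_eq_norm_mul_self, norm_of_mem_imagUnits hI, show I ^ 2 = -1 from hI]
  simp

/-- The embedding of `ℂ` into `ℍ` with image `L_I`, sending the complex imaginary unit to `I`. -/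
def sliceEmb (hI : I ∈ imagUnits) : ℂ →ₐ[ℝ] ℍ[ℝ] :=
  Complex.liftAux I (mul_self_of_mem_imagUnits hI)

theorem sliceEmb_apply (hI : I ∈ imagUnits) (z : ℂ) :
    sliceEmb hI z = slicePoint I z.re z.im := by
  rw [sliceEmb, Complex.liftAux_apply, slicePoint, Quaternion.mul_coe_eq_smul]
  rfl

theorem sliceEmb_ofReal (hI : I ∈ imagUnits) (t : ℝ) : sliceEmb hI t = (t : ℍ[ℝ]) :=
  (sliceEmb hI).commutes t

theorem sliceEmb_neg (hI : I ∈ imagUnits) (z : ℂ) :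
    sliceEmb (neg_mem_imagUnits hI) z = sliceEmb hI (starRingEnd ℂ z) := by
  simp [sliceEmb_apply, slicePoint]

theorem norm_sliceEmb (hI : I ∈ imagUnits) (z : ℂ) : ‖sliceEmb hI z‖ = ‖z‖ := by
  have h1 := Quaternion.normSq_eq_norm_mul_self I
  have h2 := Quaternion.normSq_eq_norm_mul_self (sliceEmb hI z)
  rw [norm_of_mem_imagUnits hI, Quaternion.normSq_def'] at h1
  rw [Quaternion.normSq_def', sliceEmb_apply, slicePoint, Quaternion.mul_coe_eq_smul] at h2
  simp only [Quaternion.re_add, Quaternion.imI_add, Quaternion.imJ_add, Quaternion.imK_add,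
    Quaternion.re_coe, Quaternion.imI_coe, Quaternion.imJ_coe, Quaternion.imK_coe,
    Quaternion.re_smul, Quaternion.imI_smul, Quaternion.imJ_smul, Quaternion.imK_smul,
    smul_eq_mul, re_of_mem_imagUnits hI] at h1 h2
  rw [← sq_eq_sq₀ (norm_nonneg _) (norm_nonneg _), ← Complex.normSq_eq_norm_sq,
    Complex.normSq_apply, sliceEmb_apply, slicePoint, Quaternion.mul_coe_eq_smul]
  linear_combination -h2 + z.im ^ 2 * h1

theorem continuous_sliceEmb (hI : I ∈ imagUnits) : Continuous (sliceEmb hI) :=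
  (sliceEmb hI).toLinearMap.continuous_of_finiteDimensional

/-! ### Regularity as complex differentiability -/

/-- The complex normed space structure on `ℍ` given by left multiplication by `L_I`. -/
abbrev sliceNormedSpace (hI : I ∈ imagUnits) : NormedSpace ℂ ℍ[ℝ] :=
  { Module.compHom ℍ[ℝ] (sliceEmb hI).toRingHom with
    norm_smul_le := fun z q => by
      change ‖sliceEmb hI z * q‖ ≤ _
      rw [norm_mul, norm_sliceEmb] }

/-- Multiplication of elements of `L_I` by `c` on the right, as a real-linear map on `ℂ`. -/
def sliceMulRight (hI : I ∈ imagUnits) (c : ℍ[ℝ]) : ℂ →L[ℝ] ℍ[ℝ] :=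
  LinearMap.toContinuousLinearMap
    ((LinearMap.mulRight ℝ c).comp (sliceEmb hI).toLinearMap)

theorem sliceMulRight_apply (hI : I ∈ imagUnits) (c : ℍ[ℝ]) (z : ℂ) :
    sliceMulRight hI c z = sliceEmb hI z * c := rfl

/-- `F : ℂ → ℍ` has derivative `c` at `z` with respect to left multiplication by `L_I`. -/
def HasSliceDerivAt (hI : I ∈ imagUnits) (F : ℂ → ℍ[ℝ]) (c : ℍ[ℝ]) (z : ℂ) : Prop :=
  HasFDerivAt F (sliceMulRight hI c) z

/-- Both sides unfold to the same little-o estimate, because `sliceMulRight hI c` is `w ↦ w • c` for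
this complex structure. This gives access to complex analysis of vector-valued functions. -/
theorem hasSliceDerivAt_iff_hasDerivAt (hI : I ∈ imagUnits) {F : ℂ → ℍ[ℝ]} {c : ℍ[ℝ]} {z : ℂ} :
    letI := sliceNormedSpace hI
    HasSliceDerivAt hI F c z ↔ HasDerivAt F c z := by
  let := sliceNormedSpace hI
  rw [hasDerivAt_iff_isLittleO]
  exact hasFDerivAt_iff_isLittleO

theorem HasSliceDerivAt.differentiableAt_dbarSlice_dSlice (hI : I ∈ imagUnits)
    {f : ℍ[ℝ] → ℍ[ℝ]} {c : ℍ[ℝ]} {x y : ℝ}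
    (h : HasSliceDerivAt hI (fun z => f (sliceEmb hI z)) c ⟨x, y⟩) :
    DifferentiableAt ℝ (fun z : ℝ × ℝ => f (slicePoint I z.1 z.2)) (x, y) ∧
      dbarSlice I f x y = 0 ∧ dSlice I f x y = c := by
  have hG : HasFDerivAt (fun z : ℝ × ℝ => f (slicePoint I z.1 z.2))
      ((sliceMulRight hI c).comp (Complex.equivRealProdCLM.symm : ℝ × ℝ →L[ℝ] ℂ)) (x, y) := by
    have := HasFDerivAt.comp (x, y) (f := Complex.equivRealProdCLM.symm) h
      Complex.equivRealProdCLM.symm.hasFDerivAt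
    refine this.congr_of_eventuallyEq (.of_forall fun w => ?_)
    simp [sliceEmb_apply]
  have hX : HasDerivAt (fun t : ℝ => f (slicePoint I t y)) c x := by
    have := HasFDerivAt.comp_hasDerivAt x (f := fun t : ℝ => (t, y)) hG
      ((hasDerivAt_id x).prodMk (hasDerivAt_const x y))
    refine this.congr_deriv ?_
    simp [sliceMulRight_apply, sliceEmb_apply, slicePoint]
  have hY : HasDerivAt (fun t : ℝ => f (slicePoint I x t)) (I * c) y := by
    have := HasFDerivAt.comp_hasDerivAt y (f := fun t : ℝ => (x, t)) hG
      ((hasDerivAt_const y x).prodMk (hasDerivAt_id y))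
    refine this.congr_deriv ?_
    simp [sliceMulRight_apply, sliceEmb_apply, slicePoint]
  refine ⟨hG.differentiableAt, ?_, ?_⟩
  · rw [dbarSlice, partialX, partialY, hX.deriv, hY.deriv, ← mul_assoc,
      mul_self_of_mem_imagUnits hI]
    simp
  · rw [dSlice, partialX, partialY, hX.deriv, hY.deriv, ← mul_assoc,
      mul_self_of_mem_imagUnits hI, neg_one_mul, sub_neg_eq_add, ← two_smul ℝ c, smul_smul]
    norm_num

/-- The Cauchy–Riemann equation gives `∂f/∂y = I ∂f/∂x`, so the real differential is `w ↦ (Re w + I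
Im w) ∂f/∂x`. -/
theorem hasSliceDerivAt_dSlice (hI : I ∈ imagUnits) {f : ℍ[ℝ] → ℍ[ℝ]} {x y : ℝ}
    (h : DifferentiableAt ℝ (fun z : ℝ × ℝ => f (slicePoint I z.1 z.2)) (x, y))
    (h0 : dbarSlice I f x y = 0) :
    HasSliceDerivAt hI (fun z => f (sliceEmb hI z)) (dSlice I f x y) ⟨x, y⟩ := by
  obtain ⟨G', hG⟩ := h
  have hX : partialX I f x y = G' (1, 0) :=
    (HasFDerivAt.comp_hasDerivAt x (f := fun t : ℝ => (t, y)) hG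
      ((hasDerivAt_id x).prodMk (hasDerivAt_const x y))).deriv
  have hY : partialY I f x y = G' (0, 1) :=
    (HasFDerivAt.comp_hasDerivAt y (f := fun t : ℝ => (x, t)) hG
      ((hasDerivAt_const y x).prodMk (hasDerivAt_id y))).deriv
  have hXY : G' (1, 0) + I * G' (0, 1) = 0 := by
    rw [dbarSlice, hX, hY] at h0
    exact (smul_eq_zero.mp h0).resolve_left (by norm_num)
  have hY' : I * G' (1, 0) = G' (0, 1) := by
    rw [eq_neg_of_add_eq_zero_left hXY, mul_neg, ← mul_assoc, mul_self_of_mem_imagUnits hI]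
    simp
  have hd : dSlice I f x y = G' (1, 0) := by
    rw [dSlice, hX, hY, eq_neg_of_add_eq_zero_right hXY, sub_neg_eq_add, ← two_smul ℝ, smul_smul]
    norm_num
  have hF := HasFDerivAt.comp (⟨x, y⟩ : ℂ) (f := Complex.equivRealProdCLM) hG
    Complex.equivRealProdCLM.hasFDerivAt
  rw [HasSliceDerivAt, hd]
  refine (hF.congr_fderiv ?_).congr_of_eventuallyEq (.of_forall fun z => ?_)
  · ext1 w
    have : G' (w.re, w.im) = w.re • G' (1, 0) + w.im • G' (0, 1) := by
      rw [← map_smul, ← map_smul, ← map_add]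
      simp
    simp [sliceMulRight_apply, sliceEmb_apply, slicePoint, this, ← hY', add_mul,
      Quaternion.mul_coe_eq_smul, Quaternion.coe_mul_eq_smul]
  · simp [sliceEmb_apply]

theorem IsRegularOn.hasSliceDerivAt {f : ℍ[ℝ] → ℍ[ℝ]} {Ω : Set ℍ[ℝ]} (hf : IsRegularOn f Ω)
    (hI : I ∈ imagUnits) {z : ℂ} (hz : sliceEmb hI z ∈ Ω) :
    HasSliceDerivAt hI (fun z => f (sliceEmb hI z)) (dSlice I f z.re z.im) z := by
  rw [sliceEmb_apply] at hz
  exact hasSliceDerivAt_dSlice hI (hf I hI _ _ hz).1 (hf I hI _ _ hz).2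

theorem IsRegularOn.differentiableOn {f : ℍ[ℝ] → ℍ[ℝ]} {Ω : Set ℍ[ℝ]} (hf : IsRegularOn f Ω)
    (hI : I ∈ imagUnits) :
    letI := sliceNormedSpace hI
    DifferentiableOn ℂ (fun z => f (sliceEmb hI z)) (sliceEmb hI ⁻¹' Ω) := by
  let := sliceNormedSpace hI
  exact fun z hz => ((hasSliceDerivAt_iff_hasDerivAt hI).mp
    (hf.hasSliceDerivAt hI hz)).differentiableAt.differentiableWithinAt

/-! ### The slice derivative and its iterates -/

theorem dSlice_neg (I : ℍ[ℝ]) (f : ℍ[ℝ] → ℍ[ℝ]) (x y : ℝ) :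
    dSlice (-I) f x (-y) = dSlice I f x y := by
  have h : ∀ s t : ℝ, slicePoint (-I) s (-t) = slicePoint I s t := fun s t => by
    simp [slicePoint]
  have hX : partialX (-I) f x (-y) = partialX I f x y := by
    simp only [partialX, h]
  have hY : partialY (-I) f x (-y) = -partialY I f x y := by
    rw [partialY, partialY, ← neg_neg (deriv (fun t => f (slicePoint (-I) x t)) (-y)),
      ← deriv_comp_neg]
    simp only [h]
  rw [dSlice, dSlice, hX, hY, neg_mul_neg]

theorem IsRegularOn.dSlice_eq_partialX {f : ℍ[ℝ] → ℍ[ℝ]} {Ω : Set ℍ[ℝ]} (hf : IsRegularOn f Ω)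
    (hI : I ∈ imagUnits) {x y : ℝ} (h : slicePoint I x y ∈ Ω) :
    dSlice I f x y = partialX I f x y := by
  have h0 := (hf I hI x y h).2
  rw [dbarSlice] at h0
  have h1 := (smul_eq_zero.mp h0).resolve_left (by norm_num)
  rw [dSlice, eq_neg_of_add_eq_zero_right h1, sub_neg_eq_add, ← two_smul ℝ, smul_smul]
  norm_num

theorem im_slicePoint (hI : I ∈ imagUnits) (x y : ℝ) : (slicePoint I x y).im = y • I := by
  have := re_of_mem_imagUnits hI
  ext <;> simp [slicePoint, this, mul_comm]

theorem re_slicePoint (hI : I ∈ imagUnits) (x y : ℝ) : (slicePoint I x y).re = x := by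
  simp [slicePoint, re_of_mem_imagUnits hI]

/-- A non-real point lies on `L_K` only for two opposite units `K`, which give the same derivative.
At a real point the derivative is `∂f/∂x`, computed along the real axis common to all lines. -/
theorem IsRegularOn.sliceDeriv_slicePoint {f : ℍ[ℝ] → ℍ[ℝ]} {Ω : Set ℍ[ℝ]}
    (hf : IsRegularOn f Ω) (hI : I ∈ imagUnits) {x y : ℝ} (h : slicePoint I x y ∈ Ω) :
    sliceDeriv f (slicePoint I x y) = dSlice I f x y := by
  have hn : ‖(slicePoint I x y).im‖ = |y| := by
    rw [im_slicePoint hI, norm_smul, norm_of_mem_imagUnits hI, mul_one, Real.norm_eq_abs]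
  rw [sliceDeriv, re_slicePoint hI, hn]
  have hI0 : I ≠ 0 := by
    rintro rfl
    simpa using norm_of_mem_imagUnits hI
  rcases lt_trichotomy y 0 with hy | rfl | hy
  · have : sliceUnit (slicePoint I x y) = -I := by
      rw [sliceUnit, hn, im_slicePoint hI, if_neg (smul_ne_zero hy.ne hI0), smul_smul,
        abs_of_neg hy, inv_neg, neg_mul, inv_mul_cancel₀ hy.ne, neg_smul, one_smul]
    rw [this, abs_of_neg hy, dSlice_neg]
  -- Here `sliceUnit` takes its default value `unitI`, which need not be `I` or `-I`.
  · have h0 : ∀ (K : ℍ[ℝ]) (t : ℝ), slicePoint K t 0 = t := fun K t => by simp [slicePoint]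
    rw [abs_zero, hf.dSlice_eq_partialX hI h,
      hf.dSlice_eq_partialX (sliceUnit_mem_imagUnits _) (by rwa [h0, ← h0 I])]
    simp only [partialX, h0]
  · have : sliceUnit (slicePoint I x y) = I := by
      rw [sliceUnit, hn, im_slicePoint hI, if_neg (smul_ne_zero hy.ne' hI0), smul_smul,
        abs_of_pos hy, inv_mul_cancel₀ hy.ne', one_smul]
    rw [this, abs_of_pos hy]

theorem IsRegularOn.sliceDeriv_sliceEmb {f : ℍ[ℝ] → ℍ[ℝ]} {Ω : Set ℍ[ℝ]}
    (hf : IsRegularOn f Ω) (hI : I ∈ imagUnits) {z : ℂ} (hz : sliceEmb hI z ∈ Ω) :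
    letI := sliceNormedSpace hI
    sliceDeriv f (sliceEmb hI z) = deriv (fun z => f (sliceEmb hI z)) z := by
  let := sliceNormedSpace hI
  rw [((hasSliceDerivAt_iff_hasDerivAt hI).mp (hf.hasSliceDerivAt hI hz)).deriv]
  rw [sliceEmb_apply] at hz ⊢
  exact hf.sliceDeriv_slicePoint hI hz

theorem IsRegularOn.sliceDeriv {f : ℍ[ℝ] → ℍ[ℝ]} {Ω : Set ℍ[ℝ]} (hΩ : IsOpen Ω)
    (hf : IsRegularOn f Ω) : IsRegularOn (sliceDeriv f) Ω := by
  intro I hI x y h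
  let := sliceNormedSpace hI
  have hU : IsOpen (sliceEmb hI ⁻¹' Ω) := hΩ.preimage (continuous_sliceEmb hI)
  have hz : (⟨x, y⟩ : ℂ) ∈ sliceEmb hI ⁻¹' Ω := by
    rwa [Set.mem_preimage, sliceEmb_apply]
  have hd := (((hf.differentiableOn hI).deriv hU).differentiableAt (hU.mem_nhds hz)).hasDerivAt
  have he := hd.congr_of_eventuallyEq (Filter.eventually_of_mem (hU.mem_nhds hz)
    fun w hw => hf.sliceDeriv_sliceEmb hI hw)
  have := ((hasSliceDerivAt_iff_hasDerivAt hI).mpr he).differentiableAt_dbarSlice_dSlice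
  exact ⟨this.1, this.2.1⟩

theorem IsRegularOn.isSliceDerivOn_sliceDeriv {f : ℍ[ℝ] → ℍ[ℝ]} {Ω : Set ℍ[ℝ]} (hΩ : IsOpen Ω)
    (hf : IsRegularOn f Ω) : IsSliceDerivOn f (SliceRegular.sliceDeriv f) Ω :=
  ⟨hf.sliceDeriv hΩ, fun _ hI _ _ h => hf.sliceDeriv_slicePoint hI h⟩

theorem iteratedSliceDeriv_succ (n : ℕ) (f : ℍ[ℝ] → ℍ[ℝ]) :
    iteratedSliceDeriv (n + 1) f = sliceDeriv (iteratedSliceDeriv n f) :=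
  Function.iterate_succ_apply' _ _ _

theorem IsRegularOn.iteratedSliceDeriv {f : ℍ[ℝ] → ℍ[ℝ]} {Ω : Set ℍ[ℝ]} (hΩ : IsOpen Ω)
    (hf : IsRegularOn f Ω) (n : ℕ) : IsRegularOn (iteratedSliceDeriv n f) Ω := by
  induction n with
  | zero => exact hf
  | succ n ih =>
    rw [iteratedSliceDeriv_succ]
    exact ih.sliceDeriv hΩ

theorem IsRegularOn.iteratedSliceDeriv_sliceEmb {f : ℍ[ℝ] → ℍ[ℝ]} {Ω : Set ℍ[ℝ]} (hΩ : IsOpen Ω)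
    (hf : IsRegularOn f Ω) (hI : I ∈ imagUnits) (n : ℕ) {z : ℂ} (hz : sliceEmb hI z ∈ Ω) :
    letI := sliceNormedSpace hI
    SliceRegular.iteratedSliceDeriv n f (sliceEmb hI z) =
      iteratedDeriv n (fun z => f (sliceEmb hI z)) z := by
  let := sliceNormedSpace hI
  have hU : IsOpen (sliceEmb hI ⁻¹' Ω) := hΩ.preimage (continuous_sliceEmb hI)
  induction n generalizing z with
  | zero => simp [SliceRegular.iteratedSliceDeriv]
  | succ n ih =>
    rw [iteratedSliceDeriv_succ, (hf.iteratedSliceDeriv hΩ n).sliceDeriv_sliceEmb hI hz,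
      iteratedDeriv_succ]
    exact Filter.EventuallyEq.deriv_eq (Filter.eventually_of_mem (hU.mem_nhds hz) fun w hw => ih hw)

/-! ### Taylor expansion within one complex line -/

theorem regularPow_sliceEmb (hI : I ∈ imagUnits) (z c : ℂ) (n : ℕ) :
    regularPow (sliceEmb hI z) (sliceEmb hI c) n = sliceEmb hI ((z - c) ^ n) := by
  have hinj : Function.Injective (sliceEmb hI).toRingHom := (sliceEmb hI).toRingHom.injective
  -- When coefficients and argument all lie in the commutative field `L_I`, the side on which the
  -- coefficients stand is irrelevant.
  have hev : ∀ P : Polynomial ℂ,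
      rightEval (P.map (sliceEmb hI).toRingHom) (sliceEmb hI z) = sliceEmb hI (P.eval z) := by
    intro P
    rw [rightEval, Polynomial.sum_def, Polynomial.support_map_of_injective P hinj,
      Polynomial.eval_eq_sum, Polynomial.sum_def, map_sum]
    refine Finset.sum_congr rfl fun k _ => ?_
    rw [Polynomial.coeff_map, mul_comm, map_mul, map_pow]
    rfl
  have := hev ((Polynomial.X - Polynomial.C c) ^ n)
  rw [Polynomial.map_pow, Polynomial.map_sub, Polynomial.map_X, Polynomial.map_C] at this
  rw [regularPow]
  refine this.trans ?_
  simp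

theorem IsRegularOn.hasSum_sliceEmb {f : ℍ[ℝ] → ℍ[ℝ]} {Ω : Set ℍ[ℝ]} (hΩ : IsOpen Ω)
    (hf : IsRegularOn f Ω) (hI : I ∈ imagUnits) {c z : ℂ} {R : ℝ}
    (hR : Metric.ball c R ⊆ sliceEmb hI ⁻¹' Ω) (hz : z ∈ Metric.ball c R) :
    HasSum (fun n : ℕ => regularPow (sliceEmb hI z) (sliceEmb hI c) n *
      ((n ! : ℝ)⁻¹ • SliceRegular.iteratedSliceDeriv n f (sliceEmb hI c))) (f (sliceEmb hI z)) := by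
  let := sliceNormedSpace hI
  have hc : sliceEmb hI c ∈ Ω := hR (Metric.mem_ball_self (Metric.pos_of_mem_ball hz))
  have := Complex.hasSum_taylorSeries_on_ball ((hf.differentiableOn hI).mono hR) hz
  refine Eq.mpr (congrArg (fun u => HasSum u _) (funext fun n => ?_)) this
  rw [hf.iteratedSliceDeriv_sliceEmb hΩ hI n hc, regularPow_sliceEmb]
  change _ = sliceEmb hI (n ! : ℂ)⁻¹ * (sliceEmb hI ((z - c) ^ n) * _)
  have h : ((n ! : ℂ)⁻¹) = (((n ! : ℝ)⁻¹ : ℝ) : ℂ) := by push_cast; rfl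
  rw [h, sliceEmb_ofReal, Quaternion.coe_mul_eq_smul, mul_smul_comm]

/-! ### The representation formula -/

/-- The coefficient `½ (1 - J I)` of the representation formula. -/
def reprCoeff (I J : ℍ[ℝ]) : ℍ[ℝ] := (1 / 2 : ℝ) • (1 - J * I)

theorem reprCoeff_add_reprCoeff_neg (I J : ℍ[ℝ]) : reprCoeff I J + reprCoeff (-I) J = 1 := by
  rw [reprCoeff, reprCoeff, ← smul_add, mul_neg, sub_neg_eq_add, sub_add_add_cancel,
    ← two_smul ℝ, smul_smul]
  norm_num

/-- The reason is `(1 - J I) I = I + J = J (1 - J I)`. -/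
theorem semiconjBy_reprCoeff (hI : I ∈ imagUnits) (hJ : J ∈ imagUnits) (z : ℂ) :
    SemiconjBy (reprCoeff I J) (sliceEmb hI z) (sliceEmb hJ z) := by
  have h : reprCoeff I J * I = J * reprCoeff I J := by
    rw [reprCoeff, smul_mul_assoc, mul_smul_comm, sub_mul, mul_sub, mul_assoc J, ← mul_assoc J J,
      mul_self_of_mem_imagUnits hI, mul_self_of_mem_imagUnits hJ]
    congr 1
    noncomm_ring
  rw [SemiconjBy, sliceEmb_apply, sliceEmb_apply, slicePoint, slicePoint, mul_add, add_mul,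
    ← mul_assoc, h, Quaternion.mul_coe_eq_smul, Quaternion.mul_coe_eq_smul,
    Quaternion.mul_coe_eq_smul, Quaternion.coe_mul_eq_smul, smul_mul_assoc]

/-- In each monomial the coefficients turn powers from `L_I` and `L_{-I}` into the power from `L_J`;
then they add up to 1. -/
theorem rightEval_sliceEmb (hI : I ∈ imagUnits) (hJ : J ∈ imagUnits) (P : Polynomial ℍ[ℝ])
    (z : ℂ) :
    rightEval P (sliceEmb hJ z) = reprCoeff I J * rightEval P (sliceEmb hI z) +
      reprCoeff (-I) J * rightEval P (sliceEmb (neg_mem_imagUnits hI) z) := by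
  simp only [rightEval, Polynomial.sum_def, Finset.mul_sum, ← Finset.sum_add_distrib, ← mul_assoc]
  refine Finset.sum_congr rfl fun k _ => ?_
  rw [((semiconjBy_reprCoeff hI hJ z).pow_right k).eq,
    ((semiconjBy_reprCoeff (neg_mem_imagUnits hI) hJ z).pow_right k).eq, ← add_mul, ← mul_add,
    reprCoeff_add_reprCoeff_neg, mul_one]

/-- By the intertwining relation, multiplying by the coefficient turns `I`-holomorphic functions
into `J`-holomorphic ones, so the terms of the representation formula can be compared by the
identity theorem. -/
theorem HasSliceDerivAt.reprCoeff_mul (hI : I ∈ imagUnits) (hJ : J ∈ imagUnits) {F : ℂ → ℍ[ℝ]}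
    {c : ℍ[ℝ]} {z : ℂ} (h : HasSliceDerivAt hI F c z) :
    HasSliceDerivAt hJ (fun z => reprCoeff I J * F z) (reprCoeff I J * c) z := by
  refine (HasFDerivAt.const_mul h (reprCoeff I J)).congr_fderiv ?_
  ext1 w
  change reprCoeff I J * (sliceEmb hI w * c) = sliceEmb hJ w * (reprCoeff I J * c)
  rw [← mul_assoc, ← mul_assoc, (semiconjBy_reprCoeff hI hJ w).eq]

theorem IsRegularOn.differentiableOn_reprCoeff_mul {f : ℍ[ℝ] → ℍ[ℝ]} {Ω : Set ℍ[ℝ]}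
    (hf : IsRegularOn f Ω) (hI : I ∈ imagUnits) (hJ : J ∈ imagUnits) :
    letI := sliceNormedSpace hJ
    DifferentiableOn ℂ (fun z => reprCoeff I J * f (sliceEmb hI z)) (sliceEmb hI ⁻¹' Ω) := by
  let := sliceNormedSpace hJ
  exact fun z hz => ((hasSliceDerivAt_iff_hasDerivAt hJ).mp
    ((hf.hasSliceDerivAt hI hz).reprCoeff_mul hI hJ)).differentiableAt.differentiableWithinAt

/-- A local form of the representation formula. -/
theorem IsRegularOn.apply_sliceEmb {f : ℍ[ℝ] → ℍ[ℝ]} {Ω : Set ℍ[ℝ]}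
    (hf : IsRegularOn f Ω) (hI : I ∈ imagUnits) (hJ : J ∈ imagUnits) {D : Set ℂ} (hD : IsOpen D)
    (hDc : IsPreconnected D) {t : ℝ} (ht : (t : ℂ) ∈ D) (hDJ : D ⊆ sliceEmb hJ ⁻¹' Ω)
    (hDI : D ⊆ sliceEmb hI ⁻¹' Ω) (hDI' : D ⊆ sliceEmb (neg_mem_imagUnits hI) ⁻¹' Ω)
    {z : ℂ} (hz : z ∈ D) :
    f (sliceEmb hJ z) = reprCoeff I J * f (sliceEmb hI z) +
      reprCoeff (-I) J * f (sliceEmb (neg_mem_imagUnits hI) z) := by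
  let := sliceNormedSpace hJ
  have h1 := ((hf.differentiableOn hJ).mono hDJ).analyticOnNhd hD
  have h2 := ((hf.differentiableOn_reprCoeff_mul hI hJ).mono hDI).analyticOnNhd hD
  have h3 := ((hf.differentiableOn_reprCoeff_mul (neg_mem_imagUnits hI) hJ).mono
    hDI').analyticOnNhd hD
  refine h1.eqOn_of_preconnected_of_frequently_eq (h2.add h3) hDc ht ?_ hz
  -- On the real axis the three embeddings agree and the coefficients sum to 1; real points
  -- accumulating at `t` suffice for the identity theorem.
  have hr : ∀ s : ℝ, f (sliceEmb hJ s) = reprCoeff I J * f (sliceEmb hI s) +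
      reprCoeff (-I) J * f (sliceEmb (neg_mem_imagUnits hI) s) := fun s => by
    rw [sliceEmb_ofReal, sliceEmb_ofReal, sliceEmb_ofReal, ← add_mul,
      reprCoeff_add_reprCoeff_neg, one_mul]
  have hT : Filter.Tendsto (fun s : ℝ => (s : ℂ)) (nhdsWithin t {t}ᶜ)
      (nhdsWithin (t : ℂ) {(t : ℂ)}ᶜ) := by
    refine Complex.continuous_ofReal.continuousWithinAt.tendsto_nhdsWithin fun s hs => ?_
    simpa using hs
  exact hT.frequently (Filter.Frequently.of_forall hr)

/-! ### The distances `σ` and `ω` in complex coordinates -/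

theorem norm_im_sliceEmb (hI : I ∈ imagUnits) (z : ℂ) : ‖(sliceEmb hI z).im‖ = |z.im| := by
  rw [sliceEmb_apply, im_slicePoint hI, norm_smul, norm_of_mem_imagUnits hI, mul_one,
    Real.norm_eq_abs]

theorem re_sliceEmb (hI : I ∈ imagUnits) (z : ℂ) : (sliceEmb hI z).re = z.re := by
  rw [sliceEmb_apply, re_slicePoint hI]

theorem sliceEmb_mem_complexLine (hI : I ∈ imagUnits) (z : ℂ) : sliceEmb hI z ∈ complexLine I :=
  ⟨z.re, z.im, sliceEmb_apply hI z⟩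

theorem exists_sliceEmb_eq (hI : I ∈ imagUnits) {q : ℍ[ℝ]} (hq : q ∈ complexLine I) :
    ∃ z : ℂ, sliceEmb hI z = q := by
  obtain ⟨x, y, rfl⟩ := hq
  exact ⟨⟨x, y⟩, sliceEmb_apply hI _⟩

theorem sigmaDist_sliceEmb (hI : I ∈ imagUnits) (z c : ℂ) :
    sigmaDist (sliceEmb hI z) (sliceEmb hI c) = dist z c := by
  rw [sigmaDist, if_pos ⟨I, hI, sliceEmb_mem_complexLine hI c, sliceEmb_mem_complexLine hI z⟩,
    ← map_sub, norm_sliceEmb, Complex.dist_eq]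

theorem norm_sq_eq_re_sq_add_norm_im_sq (q : ℍ[ℝ]) : ‖q‖ ^ 2 = q.re ^ 2 + ‖q.im‖ ^ 2 := by
  rw [sq ‖q‖, sq ‖q.im‖, ← Quaternion.normSq_eq_norm_mul_self,
    ← Quaternion.normSq_eq_norm_mul_self, Quaternion.normSq_def', Quaternion.normSq_def']
  simp
  ring

theorem sigmaDist_le_omegaDist (q p : ℍ[ℝ]) : sigmaDist q p ≤ omegaDist q p := by
  rw [sigmaDist]
  split_ifs
  · refine Real.le_sqrt_of_sq_le ?_
    rw [norm_sq_eq_re_sq_add_norm_im_sq, Quaternion.re_sub, Quaternion.im_sub]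
    gcongr
    exact norm_sub_le _ _
  · exact le_rfl

/-- For real `a, b`, `|a| + |b|` is the larger of `|a - b|` and `|a + b|`. Hence an `ω`-ball meets
`L_J` in the intersection of two conjugate discs. -/
theorem omegaDist_sliceEmb (hI : I ∈ imagUnits) (hJ : J ∈ imagUnits) (z c : ℂ) :
    omegaDist (sliceEmb hJ z) (sliceEmb hI c) =
      max (dist z c) (dist z (starRingEnd ℂ c)) := by
  rw [omegaDist, norm_im_sliceEmb, norm_im_sliceEmb, re_sliceEmb, re_sliceEmb, Complex.dist_eq_re_im,
    Complex.dist_eq_re_im, ← Real.sqrt_monotone.map_max, Complex.conj_re, Complex.conj_im,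
    max_add_add_left, sub_neg_eq_add]
  congr 2
  rcases abs_cases z.im with ⟨h1, h1'⟩ | ⟨h1, h1'⟩ <;>
    rcases abs_cases c.im with ⟨h2, h2'⟩ | ⟨h2, h2'⟩ <;> rw [h1, h2]
  · rw [max_eq_right (by nlinarith)]
  · rw [max_eq_left (by nlinarith)]; ring
  · rw [max_eq_left (by nlinarith)]; ring
  · rw [max_eq_right (by nlinarith)]; ring

/-! ### The expansion on `σ`-balls -/

theorem IsRegularOn.hasSum_of_mem_sigmaBall {f : ℍ[ℝ] → ℍ[ℝ]} {Ω : Set ℍ[ℝ]} (hΩ : IsOpen Ω)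
    (hf : IsRegularOn f Ω) {p q : ℍ[ℝ]} {R : ℝ} (hR : sigmaBall p R ⊆ Ω) (hq : q ∈ sigmaBall p R) :
    HasSum (fun n : ℕ => regularPow q p n *
      ((n ! : ℝ)⁻¹ • SliceRegular.iteratedSliceDeriv n f p)) (f q) := by
  have hball : ∀ {I : ℍ[ℝ]} (hI : I ∈ imagUnits) (c : ℂ), sliceEmb hI c = p →
      Metric.ball c R ⊆ sliceEmb hI ⁻¹' Ω := fun hI c hc w hw => by
    refine hR ?_
    change sigmaDist _ _ < R
    rwa [← hc, sigmaDist_sliceEmb]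
  by_cases h : ∃ I ∈ imagUnits, p ∈ complexLine I ∧ q ∈ complexLine I
  · obtain ⟨I, hI, hp, hq'⟩ := h
    obtain ⟨c, rfl⟩ := exists_sliceEmb_eq hI hp
    obtain ⟨z, rfl⟩ := exists_sliceEmb_eq hI hq'
    refine hf.hasSum_sliceEmb hΩ hI (hball hI c rfl) ?_
    rw [Metric.mem_ball, ← sigmaDist_sliceEmb hI]
    exact hq
  · have hω : omegaDist q p < R := by
      change sigmaDist q p < R at hq
      rwa [sigmaDist, if_neg h] at hq
    have hI := sliceUnit_mem_imagUnits p
    have hJ := sliceUnit_mem_imagUnits q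
    obtain ⟨c, hc⟩ := exists_sliceEmb_eq hI ⟨p.re, ‖p.im‖, (slicePoint_sliceUnit p).symm⟩
    obtain ⟨z, hz⟩ := exists_sliceEmb_eq hJ ⟨q.re, ‖q.im‖, (slicePoint_sliceUnit q).symm⟩
    generalize sliceUnit p = I at hI hc
    generalize sliceUnit q = J at hJ hz
    have hI' := neg_mem_imagUnits hI
    -- The same `p` has coordinate `conj c` on `L_{-I}`, so both Taylor series carry the same
    -- derivatives at `p`.
    have hc' : sliceEmb hI' (starRingEnd ℂ c) = p := by
      rw [sliceEmb_neg hI, Complex.conj_conj, hc]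
    let D : Set ℂ := Metric.ball c R ∩ Metric.ball (starRingEnd ℂ c) R
    have hDω : ∀ w, w ∈ D ↔ omegaDist (sliceEmb hJ w) p < R := fun w => by
      rw [← hc, omegaDist_sliceEmb, max_lt_iff]
      rfl
    have hzD : z ∈ D := by rwa [hDω, hz]
    -- Replacing `z` by its real part cannot increase `ω`; this supplies the real point of `D`
    -- needed for the identity theorem.
    have hDre : (z.re : ℂ) ∈ D := by
      rw [hDω]
      refine lt_of_le_of_lt ?_ ((hDω z).mp hzD)
      rw [omegaDist, omegaDist, re_sliceEmb, re_sliceEmb, norm_im_sliceEmb, norm_im_sliceEmb,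
        Complex.ofReal_re, Complex.ofReal_im, abs_zero]
      gcongr
      exact abs_nonneg _
    have hD : IsOpen D := Metric.isOpen_ball.inter Metric.isOpen_ball
    have hDc : IsPreconnected D :=
      ((convex_ball c R).inter (convex_ball _ R)).isPreconnected
    have hDJ : D ⊆ sliceEmb hJ ⁻¹' Ω := fun w hw =>
      hR ((sigmaDist_le_omegaDist _ _).trans_lt ((hDω w).mp hw))
    have hfq := hf.apply_sliceEmb hI hJ hD hDc hDre hDJ
      (Set.inter_subset_left.trans (hball hI c hc))
      (Set.inter_subset_right.trans (hball hI' _ hc')) hzD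
    have h1 := hf.hasSum_sliceEmb hΩ hI (hball hI c hc) hzD.1
    have h2 := hf.hasSum_sliceEmb hΩ hI' (hball hI' _ hc') hzD.2
    rw [hc] at h1
    rw [hc'] at h2
    rw [← hz, hfq]
    -- Term by term, the representation formula for the polynomial `(X - p)^n` reassembles
    -- `regularPow q p n`.
    refine Eq.mpr (congrArg (fun u => HasSum u _) (funext fun n => ?_))
      ((h1.mul_left (reprCoeff I J)).add (h2.mul_left (reprCoeff (-I) J)))
    rw [regularPow, rightEval_sliceEmb hI hJ, add_mul, mul_assoc, mul_assoc]
    rfl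

end SliceRegular

end

theorem mainTheorem2 (Ω : Set ℍ[ℝ]) (hΩ : IsOpen Ω) (hΩc : IsConnected Ω)
    (f : ℍ[ℝ] → ℍ[ℝ]) (hf : SliceRegular.IsRegularOn f Ω) :
    (∀ n : ℕ, SliceRegular.IsSliceDerivOn (SliceRegular.iteratedSliceDeriv n f)
      (SliceRegular.iteratedSliceDeriv (n + 1) f) Ω) ∧
    ∀ p ∈ Ω, ∀ R : ℝ, SliceRegular.sigmaBall p R ⊆ Ω → ∀ q ∈ SliceRegular.sigmaBall p R,
      HasSum (fun n : ℕ => SliceRegular.regularPow q p n *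
        ((n ! : ℝ)⁻¹ • SliceRegular.iteratedSliceDeriv n f p)) (f q) := by
  refine ⟨fun n => ?_, fun p _ R hR q hq => hf.hasSum_of_mem_sigmaBall hΩ hR hq⟩
  rw [SliceRegular.iteratedSliceDeriv_succ]
  exact (hf.iteratedSliceDeriv hΩ n).isSliceDerivOn_sliceDeriv hΩ
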